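/- **Setting.** Let $\mathcal T_I=(\Sigma_I,\mathcal C_I)$ be an index theory (a class of nonempty structures, all of them finite) and $\mathcal T_E=(\Sigma_E,\mathcal C_E)$ an element theory. Let $X$ be a set of array symbols, interpreted as functions from tuples of indices to elements or to indices (0-ary ones are ordinary state variables), and let $\Sigma=\Sigma_I\cup\Sigma_E\cup\{\cdot[\cdot]\}$. Let $S=(X,\iota(X),\tau(X,X'))$ be an array-based transition system and $\varphi(X)$ a property, where $\iota,\tau,\varphi$ are closed first-order formulas over $\Sigma$ and the array symbols that quantify only over indices. All entailment and satisfiability is over the models that combine a model of $\mathcal T_I$ with one of $\mathcal T_E$. For a set $\mathcal P$ of atoms $p(I,X)$ with free index variables, let $X_{\mathcal P}$ consist of a fresh predicate symbol $x_p$ for each $p\in\mathcal P$, whose arguments are the free variables of $p$. Put $H_{\mathcal P}(X_{\mathcal P},X)=\bigwedge_{p\in\mathcal P}\forall I.(x_p(I)\leftrightarrow p(I,X))$ and $EQ_{\mathcal P}(X,Y)=\bigwedge_{p\in\mathcal P}\forall I.(p(I,X)\leftrightarrow p(I,Y))$. Write $\bar\psi$ for $\psi$ with each atom $p$ replaced by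 $x_p$. The diagram of a finite structure over $\Sigma_I\cup X_{\mathcal P}$ is the existential closure of the conjunction of all literals that describe it (distinctness of its elements, values of functions and constants, truth values of predicates). Let $$AbsRelInd(F,\tau,\psi,\mathcal P)=F(X_{\mathcal P})\wedge\psi(X_{\mathcal P})\wedge H_{\mathcal P}(X_{\mathcal P},X)\wedge EQ_{\mathcal P}(X,Y)\wedge\tau(Y,Y')\wedge EQ_{\mathcal P}(Y',X')\wedge\neg\psi(X'_{\mathcal P})\wedge H_{\mathcal P}(X'_{\mathcal P},X').$$ **Algorithm (UPDR with implicit abstraction).** Start with $\mathcal P$ the set of atoms occurring in $\iota$ and $\varphi$. If $\bar\iota\wedge H_{\mathcal P}\not\models\bar\varphi$, a counterexample in the initial states has been found and the algorithm stops. Otherwise set $F_0=\{\bar\iota\}$, $k=1$, $F_1=\emptyset$ and repeat: * While $F_k\wedge H_{\mathcal P}\wedge\neg\bar\varphi$ is satisfiable, take a model, let $\psi$ be the diagram over $\Sigma_I\cup X_{\mathcal P}$ of its restriction to the index sort, and call $RecBlock(\psi,k)$. If the call returns false, an abstract counterexample has been found; then either the algorithm stops because it is made concrete, or finitely many new atoms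 are added to $\mathcal P$. * When no model is left, increase $k$ by one, put $F_k=\emptyset$, and for $i=1,\dots,k-1$ add to $F_{i+1}$ every $f\in F_i$ for which $AbsRelInd(F_i,\tau,f,\mathcal P)$ is unsatisfiable. Stop ("safe") if $F_i=F_{i+1}$ for some $1\le i<k$. $RecBlock(\psi,0)$ returns false. For $N\ge1$, $RecBlock(\psi,N)$ does the following: while $AbsRelInd(F_{N-1},\tau,\neg\psi,\mathcal P)$ is satisfiable, it takes a model, lets $\psi'$ be the diagram of the index restriction of its pre-state (the interpretation of $\Sigma_I\cup X_{\mathcal P}$), and returns false if $RecBlock(\psi',N-1)$ does. When the formula is unsatisfiable, it adds to $F_1,\dots,F_N$ some closed formula over $\Sigma_I\cup X_{\mathcal P}$ that implies $\neg\psi$, and returns true. The choices of models, of these formulas, of the new atoms, and of whether to stop or to refine after an abstract counterexample, are arbitrary. **Proposition (Partial completeness).** Let $\mathcal L(\mathcal P)$ be the set of closed formulas $\forall\underline i.\,\psi(\underline i)$ with $\psi(\underline i)$ a Boolean combination of $\Sigma_I(\underline i)$-atoms and of instances over $\underline i$ of predicates in $\mathcal P$ (the free variables of $p\in\mathcal P$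 are replaced by variables in $\underline i$ or, more generally, by $\Sigma_I(\underline i)$-terms). If some run of the algorithm finds an abstract counterexample while its current set of predicates is $\mathcal P$ (the check of the initial states fails, or a call of $RecBlock$ from the main loop returns false), then no formula in $\mathcal L(\mathcal P)$ is an inductive invariant for $S$ and $\varphi$. That is, there is no $\chi\in\mathcal L(\mathcal P)$ with $\iota\models\chi$, $\chi(X)\wedge\tau(X,X')\models\chi(X')$ and $\chi\models\varphi$. -/

import Mathlib

universe u

namespace UpdrIA

/-! ## First-order formulas over an arbitrary set of atoms

Quantified variables are named by natural numbers and range over the index sort only. -/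

inductive Fml (A : Type u) : Type u
  | fls : Fml A
  | atom (a : A) : Fml A
  | neg (f : Fml A) : Fml A
  | and (f g : Fml A) : Fml A
  | or (f g : Fml A) : Fml A
  | all (i : ℕ) (f : Fml A) : Fml A
  | ex (i : ℕ) (f : Fml A) : Fml A

namespace Fml

/-- Truth under a variable assignment, given the truth of the atoms under every assignment. -/
def Realize {A : Type u} {M : Type u} (sat : (ℕ → M) → A → Prop) : Fml A → (ℕ → M) → Prop
  | fls, _ => False
  | atom a, ν => sat ν a
  | neg f, ν => ¬ f.Realize sat ν
  | and f g, ν => f.Realize sat ν ∧ g.Realize sat ν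
  | or f g, ν => f.Realize sat ν ∨ g.Realize sat ν
  | all i f, ν => ∀ m : M, f.Realize sat (Function.update ν i m)
  | ex i f, ν => ∃ m : M, f.Realize sat (Function.update ν i m)

/-- Free variables, given the variables of each atom. -/
def fv {A : Type u} (fvA : A → Set ℕ) : Fml A → Set ℕ
  | fls => ∅
  | atom a => fvA a
  | neg f => f.fv fvA
  | and f g => f.fv fvA ∪ g.fv fvA
  | or f g => f.fv fvA ∪ g.fv fvA
  | all i f => f.fv fvA \ {i}
  | ex i f => f.fv fvA \ {i}

/-- The atoms occurring in a formula. -/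
def atoms {A : Type u} : Fml A → Set A
  | fls => ∅
  | atom a => {a}
  | neg f => f.atoms
  | and f g => f.atoms ∪ g.atoms
  | or f g => f.atoms ∪ g.atoms
  | all _ f => f.atoms
  | ex _ f => f.atoms

/-- Replacement of every atom. -/
def map {A B : Type u} (h : A → B) : Fml A → Fml B
  | fls => fls
  | atom a => atom (h a)
  | neg f => neg (f.map h)
  | and f g => and (f.map h) (g.map h)
  | or f g => or (f.map h) (g.map h)
  | all i f => all i (f.map h)
  | ex i f => ex i (f.map h)

/-- `∀ i₁ … iₙ. f` -/
def alls {A : Type u} (l : List ℕ) (f : Fml A) : Fml A := l.foldr all f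

/-- `∃ i₁ … iₙ. f` -/
def exs {A : Type u} (l : List ℕ) (f : Fml A) : Fml A := l.foldr ex f

/-- Finite conjunction. -/
def conj {A : Type u} (l : List (Fml A)) : Fml A := l.foldr and (neg fls)

/-- Boolean combinations of the atoms in `B`. -/
inductive IsBoolComb {A : Type u} (B : Set A) : Fml A → Prop
  | fls : IsBoolComb B fls
  | atom {a : A} (h : a ∈ B) : IsBoolComb B (atom a)
  | neg {f : Fml A} (hf : IsBoolComb B f) : IsBoolComb B (neg f)
  | and {f g : Fml A} (hf : IsBoolComb B f) (hg : IsBoolComb B g) : IsBoolComb B (and f g)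
  | or {f g : Fml A} (hf : IsBoolComb B f) (hg : IsBoolComb B g) : IsBoolComb B (or f g)

end Fml

/-! ## Theories -/

/-- A theory over the signature `L`: a class of (nonempty) `L`-structures. -/
structure SMTTheory (L : FirstOrder.Language.{u, u}) where
  IsModel : (M : Type u) → L.Structure M → Prop
  nonempty : ∀ (M : Type u) (str : L.Structure M), IsModel M str → Nonempty M

/-- An index theory: no model has an infinite universe. -/
structure IndexTheory (L : FirstOrder.Language.{u, u}) extends SMTTheory L where
  finite : ∀ (M : Type u) (str : L.Structure M), IsModel M str → Finite M

/-! ## Array symbols, terms, atoms -/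

/-- A set of array symbols. `Elt n` are the symbols for functions from `n`-tuples of indices to
elements, `Idx n` those for functions from `n`-tuples of indices to indices.  The 0-ary symbols are
the state variables of element sort and of index sort. -/
structure ArraySig where
  Idx : ℕ → Type u
  Elt : ℕ → Type u

/-- Two disjoint copies `X`, `X'` of the array symbols. -/
def ArraySig.double (X : ArraySig.{u}) : ArraySig.{u} where
  Idx n := X.Idx n ⊕ X.Idx n
  Elt n := X.Elt n ⊕ X.Elt n

/-- Terms of index sort over `Σ(X)`, with variables of index sort named by `V`. -/
inductive IdxTerm (LI : FirstOrder.Language.{u, u}) (X : ArraySig.{u}) (V : Type) : Type u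
  | var (v : V) : IdxTerm LI X V
  | func {n : ℕ} (f : LI.Functions n) (ts : Fin n → IdxTerm LI X V) : IdxTerm LI X V
  | read {n : ℕ} (x : X.Idx n) (ts : Fin n → IdxTerm LI X V) : IdxTerm LI X V

/-- Terms of element sort over `Σ(X)`. -/
inductive EltTerm (LI LE : FirstOrder.Language.{u, u}) (X : ArraySig.{u}) (V : Type) : Type u
  | func {n : ℕ} (f : LE.Functions n) (ts : Fin n → EltTerm LI LE X V) : EltTerm LI LE X V
  | read {n : ℕ} (x : X.Elt n) (ts : Fin n → IdxTerm LI X V) : EltTerm LI LE X V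

/-- Atoms over `Σ(X)` whose free variables are of index sort. -/
inductive Atom (LI LE : FirstOrder.Language.{u, u}) (X : ArraySig.{u}) (V : Type) : Type u
  | idxEq (t t' : IdxTerm LI X V) : Atom LI LE X V
  | idxRel {n : ℕ} (r : LI.Relations n) (ts : Fin n → IdxTerm LI X V) : Atom LI LE X V
  | eltEq (t t' : EltTerm LI LE X V) : Atom LI LE X V
  | eltRel {n : ℕ} (r : LE.Relations n) (ts : Fin n → EltTerm LI LE X V) : Atom LI LE X V

/-- `Σ(X)`-formulas in which only variables of index sort are quantified. -/
abbrev Formula (LI LE : FirstOrder.Language.{u, u}) (X : ArraySig.{u}) : Type u :=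
  Fml (Atom LI LE X ℕ)

section Expressions

variable {LI LE : FirstOrder.Language.{u, u}} {X : ArraySig.{u}} {V W : Type}

def IdxTerm.fv : IdxTerm LI X V → Set V
  | .var v => {v}
  | .func _ ts => ⋃ j, (ts j).fv
  | .read _ ts => ⋃ j, (ts j).fv

def EltTerm.fv : EltTerm LI LE X V → Set V
  | .func _ ts => ⋃ j, (ts j).fv
  | .read _ ts => ⋃ j, (ts j).fv

def Atom.fv : Atom LI LE X V → Set V
  | .idxEq t t' => t.fv ∪ t'.fv
  | .idxRel _ ts => ⋃ j, (ts j).fv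
  | .eltEq t t' => t.fv ∪ t'.fv
  | .eltRel _ ts => ⋃ j, (ts j).fv

/-- Simultaneous substitution of index terms for the variables. -/
def IdxTerm.subst (θ : V → IdxTerm LI X W) : IdxTerm LI X V → IdxTerm LI X W
  | .var v => θ v
  | .func f ts => .func f fun j => (ts j).subst θ
  | .read x ts => .read x fun j => (ts j).subst θ

def EltTerm.subst (θ : V → IdxTerm LI X W) : EltTerm LI LE X V → EltTerm LI LE X W
  | .func f ts => .func f fun j => (ts j).subst θ
  | .read x ts => .read x fun j => (ts j).subst θ

def Atom.subst (θ : V → IdxTerm LI X W) : Atom LI LE X V → Atom LI LE X W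
  | .idxEq t t' => .idxEq (t.subst θ) (t'.subst θ)
  | .idxRel r ts => .idxRel r fun j => (ts j).subst θ
  | .eltEq t t' => .eltEq (t.subst θ) (t'.subst θ)
  | .eltRel r ts => .eltRel r fun j => (ts j).subst θ

/-- A `Σ_I`-term as a `Σ(X)`-term. -/
def IdxTerm.ofTerm : LI.Term V → IdxTerm LI X V
  | .var v => .var v
  | .func f ts => .func f fun j => IdxTerm.ofTerm (ts j)

/-- No free variables. -/
def Formula.IsClosed (f : Formula LI LE X) : Prop := f.fv Atom.fv = ∅

end Expressions

/-- An array-based transition system `(X, ι(X), τ(X, X'))`. -/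
structure ArraySystem (LI LE : FirstOrder.Language.{u, u}) (X : ArraySig.{u}) where
  init : Formula LI LE X
  trans : Formula LI LE X.double
  init_closed : init.IsClosed
  trans_closed : trans.IsClosed

/-! ## Semantics -/

/-- A model of the combined theory: an index model and an element model. The array symbols are
interpreted by a `Valuation`, and reading an array is function application. -/
structure Model {LI LE : FirstOrder.Language.{u, u}} (TI : IndexTheory LI) (TE : SMTTheory LE) where
  I : Type u
  E : Type u
  strI : LI.Structure I
  strE : LE.Structure E
  isModelI : TI.IsModel I strI
  isModelE : TE.IsModel E strE

attribute [instance] Model.strI Model.strE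

/-- An interpretation of the array symbols as functions. -/
structure Valuation (X : ArraySig.{u}) (I E : Type u) where
  idx : ∀ {n : ℕ}, X.Idx n → (Fin n → I) → I
  elt : ∀ {n : ℕ}, X.Elt n → (Fin n → I) → E

/-- The interpretation of `X, X'` given by a pair of interpretations of `X`. -/
def Valuation.pair {X : ArraySig.{u}} {I E : Type u} (s s' : Valuation X I E) :
    Valuation X.double I E where
  idx {_} := Sum.elim s.idx s'.idx
  elt {_} := Sum.elim s.elt s'.elt

section Semantics

variable {LI LE : FirstOrder.Language.{u, u}} {X : ArraySig.{u}} {V : Type}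
  {I E : Type u} [LI.Structure I] [LE.Structure E]

def IdxTerm.eval (s : Valuation X I E) (ν : V → I) : IdxTerm LI X V → I
  | .var v => ν v
  | .func f ts => FirstOrder.Language.Structure.funMap f fun j => (ts j).eval s ν
  | .read x ts => s.idx x fun j => (ts j).eval s ν

def EltTerm.eval (s : Valuation X I E) (ν : V → I) : EltTerm LI LE X V → E
  | .func f ts => FirstOrder.Language.Structure.funMap f fun j => (ts j).eval s ν
  | .read x ts => s.elt x fun j => (ts j).eval s ν

def Atom.Realize (s : Valuation X I E) (ν : V → I) : Atom LI LE X V → Prop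
  | .idxEq t t' => t.eval s ν = t'.eval s ν
  | .idxRel r ts => FirstOrder.Language.Structure.RelMap r fun j => (ts j).eval s ν
  | .eltEq t t' => t.eval s ν = t'.eval s ν
  | .eltRel r ts => FirstOrder.Language.Structure.RelMap r fun j => (ts j).eval s ν

/-- `M, s ⊨ f`; for the closed formulas to which it is applied the assignment is irrelevant. -/
def Formula.Holds (f : Formula LI LE X) (s : Valuation X I E) : Prop :=
  ∀ ν : ℕ → I, Fml.Realize (Atom.Realize s) f ν

end Semantics

section Algorithm

variable {LI LE : FirstOrder.Language.{u, u}} {X : ArraySig.{u}}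

/-- `χ` is an inductive invariant for `S` and `φ`:
`ι ⊨ χ`, `χ(X) ∧ τ(X, X') ⊨ χ(X')` and `χ ⊨ φ`. -/
def IsInductiveInvariantFor (TI : IndexTheory LI) (TE : SMTTheory LE) (S : ArraySystem LI LE X)
    (φ χ : Formula LI LE X) : Prop :=
  (∀ (M : Model TI TE) (s : Valuation X M.I M.E), S.init.Holds s → χ.Holds s) ∧
  (∀ (M : Model TI TE) (s s' : Valuation X M.I M.E),
    χ.Holds s → S.trans.Holds (s.pair s') → χ.Holds s') ∧
  (∀ (M : Model TI TE) (s : Valuation X M.I M.E), χ.Holds s → φ.Holds s)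

/-! ## The universal class `𝓛` -/

/-- Atoms over `Σ_I`. -/
def indexAtoms (LI LE : FirstOrder.Language.{u, u}) (X : ArraySig.{u}) : Set (Atom LI LE X ℕ) :=
  {a | (∃ t t' : LI.Term ℕ, a = .idxEq (.ofTerm t) (.ofTerm t')) ∨
    ∃ (n : ℕ) (r : LI.Relations n) (ts : Fin n → LI.Term ℕ), a = .idxRel r fun j => .ofTerm (ts j)}

/-- Instances of the predicates in `P`: the free variables are replaced by `Σ_I`-terms (in
particular, they may be renamed). -/
def predicateInstances (P : Set (Atom LI LE X ℕ)) : Set (Atom LI LE X ℕ) :=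
  {a | ∃ p ∈ P, ∃ θ : ℕ → LI.Term ℕ, a = p.subst fun i => .ofTerm (θ i)}

/-- The class `𝓛` of closed formulas `∀ i. ψ(i)` with `ψ(i)` a Boolean combination of `Σ_I(i)`-atoms
and of elements of `P(i)`. -/
def universalClass (P : Set (Atom LI LE X ℕ)) : Set (Formula LI LE X) :=
  {χ | ∃ (l : List ℕ) (ψ : Formula LI LE X),
    Fml.IsBoolComb (indexAtoms LI LE X ∪ predicateInstances P) ψ ∧
    ψ.fv Atom.fv ⊆ {i | i ∈ l} ∧ χ = Fml.alls l ψ}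

/-! ## The abstract signature `Σ_I ∪ X_P` -/

/-- Atoms over `Σ_I` and the fresh predicate symbols `x_p`; the places of `x_p` are labelled by the
free variables of `p`. There is a symbol for every `p`; which of them belong to `X_P` is recorded
by `AbsAtom.IsOver`. -/
inductive AbsAtom (LI LE : FirstOrder.Language.{u, u}) (X : ArraySig.{u}) : Type u
  | idxEq (t t' : LI.Term ℕ) : AbsAtom LI LE X
  | idxRel {n : ℕ} (r : LI.Relations n) (ts : Fin n → LI.Term ℕ) : AbsAtom LI LE X
  | pred (p : Atom LI LE X ℕ) (ts : p.fv → LI.Term ℕ) : AbsAtom LI LE X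

abbrev AbsFormula (LI LE : FirstOrder.Language.{u, u}) (X : ArraySig.{u}) : Type u :=
  Fml (AbsAtom LI LE X)

/-- Interpretations of the predicate symbols `x_p` over an index universe. -/
def AbsValuation (LI LE : FirstOrder.Language.{u, u}) (X : ArraySig.{u}) (I : Type u) : Type u :=
  (p : Atom LI LE X ℕ) → (p.fv → I) → Prop

def AbsAtom.fv : AbsAtom LI LE X → Set ℕ
  | .idxEq t t' => {i | i ∈ t.varFinset} ∪ {i | i ∈ t'.varFinset}
  | .idxRel _ ts => {i | ∃ j, i ∈ (ts j).varFinset}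
  | .pred _ ts => {i | ∃ j, i ∈ (ts j).varFinset}

/-- The atom belongs to the signature `Σ_I ∪ X_P`. -/
def AbsAtom.IsOver (P : Set (Atom LI LE X ℕ)) : AbsAtom LI LE X → Prop
  | .idxEq _ _ => True
  | .idxRel _ _ => True
  | .pred p _ => p ∈ P

def AbsAtom.Realize {I : Type u} [LI.Structure I] (σ : AbsValuation LI LE X I) (ν : ℕ → I) :
    AbsAtom LI LE X → Prop
  | .idxEq t t' => t.realize ν = t'.realize ν
  | .idxRel r ts => FirstOrder.Language.Structure.RelMap r fun j => (ts j).realize ν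
  | .pred p ts => σ p fun i => (ts i).realize ν

def AbsFormula.Holds {I : Type u} [LI.Structure I] (f : AbsFormula LI LE X)
    (σ : AbsValuation LI LE X I) : Prop :=
  ∀ ν : ℕ → I, Fml.Realize (AbsAtom.Realize σ) f ν

/-- The formula with every atom `p` replaced by `x_p`. -/
def Formula.bar (f : Formula LI LE X) : AbsFormula LI LE X :=
  f.map fun p => .pred p fun i => .var i

/-- `H_P(X_P, X)`: for every `p ∈ P`, `∀ I. x_p(I) ↔ p(I, X)`. -/
def HoldsH {I E : Type u} [LI.Structure I] [LE.Structure E] (P : Set (Atom LI LE X ℕ))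
    (σ : AbsValuation LI LE X I) (s : Valuation X I E) : Prop :=
  ∀ p ∈ P, ∀ ν : ℕ → I, σ p (fun i => ν i) ↔ p.Realize s ν

/-- `EQ_P(X, X')`: for every `p ∈ P`, `∀ I. p(I, X) ↔ p(I, X')`. -/
def HoldsEQ {I E : Type u} [LI.Structure I] [LE.Structure E] (P : Set (Atom LI LE X ℕ))
    (s s' : Valuation X I E) : Prop :=
  ∀ p ∈ P, ∀ ν : ℕ → I, p.Realize s ν ↔ p.Realize s' ν

/-! ## Diagrams -/

/-- The literals of the diagram over `Σ_I ∪ X_P`, the element `m` being named by the variable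
`x m`. Constants are the 0-ary functions. -/
inductive DiagramLiteral {I : Type u} [LI.Structure I] (P : Set (Atom LI LE X ℕ))
    (σ : AbsValuation LI LE X I) (x : I → ℕ) : AbsFormula LI LE X → Prop
  | ne (m m' : I) (h : m ≠ m') :
      DiagramLiteral P σ x (.neg (.atom (.idxEq (.var (x m)) (.var (x m')))))
  | relPos {n : ℕ} (r : LI.Relations n) (ms : Fin n → I)
      (h : FirstOrder.Language.Structure.RelMap r ms) :
      DiagramLiteral P σ x (.atom (.idxRel r fun j => .var (x (ms j))))
  | relNeg {n : ℕ} (r : LI.Relations n) (ms : Fin n → I)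
      (h : ¬ FirstOrder.Language.Structure.RelMap r ms) :
      DiagramLiteral P σ x (.neg (.atom (.idxRel r fun j => .var (x (ms j)))))
  | predPos (p : Atom LI LE X ℕ) (hp : p ∈ P) (ms : p.fv → I) (h : σ p ms) :
      DiagramLiteral P σ x (.atom (.pred p fun i => .var (x (ms i))))
  | predNeg (p : Atom LI LE X ℕ) (hp : p ∈ P) (ms : p.fv → I) (h : ¬ σ p ms) :
      DiagramLiteral P σ x (.neg (.atom (.pred p fun i => .var (x (ms i)))))
  | func {n : ℕ} (f : LI.Functions n) (ms : Fin n → I) :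
      DiagramLiteral P σ x (.atom (.idxEq (.func f fun j => .var (x (ms j)))
        (.var (x (FirstOrder.Language.Structure.funMap f ms)))))

/-- `ψ` is the diagram of the index model with the interpretation `σ` of `X_P`, up to the names of
the variables and the order of the literals: the existential closure of the conjunction of the
literals above. -/
def IsDiagram {I : Type u} [LI.Structure I] (P : Set (Atom LI LE X ℕ))
    (σ : AbsValuation LI LE X I) (ψ : AbsFormula LI LE X) : Prop :=
  ∃ (x : I → ℕ) (vs : List ℕ) (ls : List (AbsFormula LI LE X)),
    Function.Injective x ∧ (∀ i, i ∈ vs ↔ i ∈ Set.range x) ∧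
    (∀ f, f ∈ ls ↔ DiagramLiteral P σ x f) ∧ ψ = Fml.exs vs (Fml.conj ls)

/-! ## The algorithm

The choice of models, diagrams and generalizations, and the outcomes of the subroutines that
concretize a counterexample and refine the predicates, are nondeterministic: the relations below
describe all possible runs. -/

/-- Frames `F₀, F₁, …`; a frame is a set of formulas, read as their conjunction. -/
abbrev Frames (LI LE : FirstOrder.Language.{u, u}) (X : ArraySig.{u}) : Type u :=
  ℕ → Set (AbsFormula LI LE X)

/-- `σ, s, s₁, s₁', s', σ'` satisfy `AbsRelInd(F, τ, ψ, P)`, that is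
`F(X_P) ∧ ψ(X_P) ∧ H(X_P, X) ∧ EQ(X, Y) ∧ τ(Y, Y') ∧ EQ(Y', X') ∧ ¬ψ(X_P') ∧ H(X_P', X')`. -/
structure AbsRelInd {I E : Type u} [LI.Structure I] [LE.Structure E] (S : ArraySystem LI LE X)
    (P : Set (Atom LI LE X ℕ)) (F : Set (AbsFormula LI LE X)) (ψ : AbsFormula LI LE X)
    (σ : AbsValuation LI LE X I) (s s₁ s₁' s' : Valuation X I E)
    (σ' : AbsValuation LI LE X I) : Prop where
  frame : ∀ f ∈ F, AbsFormula.Holds f σ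
  pre : AbsFormula.Holds ψ σ
  absPre : HoldsH P σ s
  eqPre : HoldsEQ P s s₁
  step : S.trans.Holds (s₁.pair s₁')
  eqPost : HoldsEQ P s₁' s'
  post : ¬ AbsFormula.Holds ψ σ'
  absPost : HoldsH P σ' s'

/-- `AbsRelInd(F, τ, ψ, P)` is satisfiable. -/
def AbsRelIndSat (TI : IndexTheory LI) (TE : SMTTheory LE) (S : ArraySystem LI LE X)
    (P : Set (Atom LI LE X ℕ)) (F : Set (AbsFormula LI LE X)) (ψ : AbsFormula LI LE X) : Prop :=
  ∃ (M : Model TI TE) (σ : AbsValuation LI LE X M.I) (s s₁ s₁' s' : Valuation X M.I M.E)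
    (σ' : AbsValuation LI LE X M.I), AbsRelInd S P F ψ σ s s₁ s₁' s' σ'

/-- `g` is a possible result of generalizing `¬ψ`: a closed formula over `Σ_I ∪ X_P` that implies
`¬ψ`. -/
def IsGeneralization (TI : IndexTheory LI) (P : Set (Atom LI LE X ℕ))
    (ψ g : AbsFormula LI LE X) : Prop :=
  Fml.fv AbsAtom.fv g = ∅ ∧ (∀ a ∈ g.atoms, a.IsOver P) ∧
  ∀ (I : Type u) (str : LI.Structure I), TI.IsModel I str →
    ∀ σ : AbsValuation LI LE X I, AbsFormula.Holds g σ → ¬ AbsFormula.Holds ψ σ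

/-- Add `g` to `F₁, …, F_N`. -/
def Frames.add (F : Frames LI LE X) (N : ℕ) (g : AbsFormula LI LE X) : Frames LI LE X :=
  fun i => {f | f ∈ F i ∨ (1 ≤ i ∧ i ≤ N ∧ f = g)}

/-- `RecBlock TI TE S P F ψ N b F'`: started with frames `F`, the call `RecBlock(ψ, N)` can return
the truth value `b` with frames `F'`. -/
inductive RecBlock (TI : IndexTheory LI) (TE : SMTTheory LE) (S : ArraySystem LI LE X)
    (P : Set (Atom LI LE X ℕ)) :
    Frames LI LE X → AbsFormula LI LE X → ℕ → Bool → Frames LI LE X → Prop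
  /-- `N = 0`: return false. -/
  | zero (F : Frames LI LE X) (ψ : AbsFormula LI LE X) : RecBlock TI TE S P F ψ 0 false F
  /-- The loop condition holds, and the recursive call on the diagram of the model found fails:
  return false. -/
  | fail {F F' : Frames LI LE X} {ψ ψ' : AbsFormula LI LE X} {N : ℕ} (M : Model TI TE)
      (σ σ' : AbsValuation LI LE X M.I) (s s₁ s₁' s' : Valuation X M.I M.E)
      (hsat : AbsRelInd S P (F N) (.neg ψ) σ s s₁ s₁' s' σ') (hdiag : IsDiagram P σ ψ')
      (hrec : RecBlock TI TE S P F ψ' N false F') : RecBlock TI TE S P F ψ (N + 1) false F'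
  /-- The loop condition holds, and the recursive call on the diagram of the model found succeeds:
  go back to the loop condition. -/
  | loop {F F' F'' : Frames LI LE X} {ψ ψ' : AbsFormula LI LE X} {N : ℕ} {b : Bool}
      (M : Model TI TE)
      (σ σ' : AbsValuation LI LE X M.I) (s s₁ s₁' s' : Valuation X M.I M.E)
      (hsat : AbsRelInd S P (F N) (.neg ψ) σ s s₁ s₁' s' σ') (hdiag : IsDiagram P σ ψ')
      (hrec : RecBlock TI TE S P F ψ' N true F')
      (hcont : RecBlock TI TE S P F' ψ (N + 1) b F'') : RecBlock TI TE S P F ψ (N + 1) b F''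
  /-- The loop condition fails: generalize, strengthen the frames, return true. -/
  | block {F : Frames LI LE X} {ψ g : AbsFormula LI LE X} {N : ℕ}
      (hunsat : ¬ AbsRelIndSat TI TE S P (F N) (.neg ψ)) (hg : IsGeneralization TI P ψ g) :
      RecBlock TI TE S P F ψ (N + 1) true (F.add (N + 1) g)

/-- The initial predicates: the atoms occurring in `ι` and `φ`. -/
def initPredicates (S : ArraySystem LI LE X) (φ : Formula LI LE X) : Set (Atom LI LE X ℕ) :=
  S.init.atoms ∪ φ.atoms

/-- The check of the initial states: `ῑ ∧ H_P ⊨ φ̄`. -/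
def InitCheck (TI : IndexTheory LI) (TE : SMTTheory LE) (S : ArraySystem LI LE X)
    (φ : Formula LI LE X) : Prop :=
  ∀ (M : Model TI TE) (σ : AbsValuation LI LE X M.I) (s : Valuation X M.I M.E),
    AbsFormula.Holds S.init.bar σ → HoldsH (initPredicates S φ) σ s → AbsFormula.Holds φ.bar σ

/-- The initial frames: `F₀ = {ῑ}` and no formula in the others. -/
def initFrames (S : ArraySystem LI LE X) : Frames LI LE X :=
  Function.update (fun _ => ∅) 0 {S.init.bar}

/-- `σ, s` satisfy `F ∧ H_P ∧ ¬φ̄`. -/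
structure IsBadModel {I E : Type u} [LI.Structure I] [LE.Structure E] (φ : Formula LI LE X)
    (P : Set (Atom LI LE X ℕ)) (F : Set (AbsFormula LI LE X))
    (σ : AbsValuation LI LE X I) (s : Valuation X I E) : Prop where
  frame : ∀ f ∈ F, AbsFormula.Holds f σ
  absRel : HoldsH P σ s
  bad : ¬ AbsFormula.Holds φ.bar σ

/-- The propagation phase for `i = 1, …, n`: add to `F_{i+1}` each `f ∈ F_i` for which
`AbsRelInd(F_i, τ, f, P)` is unsatisfiable. -/
def propagate (TI : IndexTheory LI) (TE : SMTTheory LE) (S : ArraySystem LI LE X)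
    (P : Set (Atom LI LE X ℕ)) (F : Frames LI LE X) : ℕ → Frames LI LE X
  | 0 => F
  | n + 1 =>
    let G := propagate TI TE S P F n
    Function.update G (n + 2)
      (G (n + 2) ∪ {f | f ∈ G (n + 1) ∧ ¬ AbsRelIndSat TI TE S P (G (n + 1)) f})

/-- The algorithm can arrive at the condition `F_k ∧ H_P ∧ ¬φ̄ is sat` of its inner loop with
predicates `P`, counter `k` and frames `F`. -/
inductive Reaches (TI : IndexTheory LI) (TE : SMTTheory LE) (S : ArraySystem LI LE X)
    (φ : Formula LI LE X) : Set (Atom LI LE X ℕ) → ℕ → Frames LI LE X → Prop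
  | start (h : InitCheck TI TE S φ) : Reaches TI TE S φ (initPredicates S φ) 1 (initFrames S)
  /-- A diagram is blocked. -/
  | block {P : Set (Atom LI LE X ℕ)} {k : ℕ} {F F' : Frames LI LE X} {ψ : AbsFormula LI LE X}
      (h : Reaches TI TE S φ P k F) (M : Model TI TE) (σ : AbsValuation LI LE X M.I)
      (s : Valuation X M.I M.E) (hσ : IsBadModel φ P (F k) σ s) (hdiag : IsDiagram P σ ψ)
      (hrec : RecBlock TI TE S P F ψ k true F') : Reaches TI TE S φ P k F'
  /-- An abstract counterexample is found, it is not concretized, and a finite set `R` of predicates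
  is added. -/
  | refine {P : Set (Atom LI LE X ℕ)} {k : ℕ} {F F' : Frames LI LE X} {ψ : AbsFormula LI LE X}
      (h : Reaches TI TE S φ P k F) (M : Model TI TE) (σ : AbsValuation LI LE X M.I)
      (s : Valuation X M.I M.E) (hσ : IsBadModel φ P (F k) σ s) (hdiag : IsDiagram P σ ψ)
      (hrec : RecBlock TI TE S P F ψ k false F')
      (R : Set (Atom LI LE X ℕ)) (hR : R.Finite) : Reaches TI TE S φ (P ∪ R) k F'
  /-- No model is left: open an empty new frame, propagate, and go on if no two consecutive frames
  are equal. -/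
  | extend {P : Set (Atom LI LE X ℕ)} {k : ℕ} {F F' : Frames LI LE X}
      (h : Reaches TI TE S φ P k F)
      (hunsat : ∀ (M : Model TI TE) (σ : AbsValuation LI LE X M.I) (s : Valuation X M.I M.E),
        ¬ IsBadModel φ P (F k) σ s)
      (hF' : F' = propagate TI TE S P (Function.update F (k + 1) ∅) k)
      (hne : ∀ i, 1 ≤ i → i ≤ k → F' i ≠ F' (i + 1)) : Reaches TI TE S φ P (k + 1) F'

/-- Some run of the algorithm finds an abstract counterexample while its current set of predicates
is `P`: either the check of the initial states fails, or a call of `RecBlock` from the main loop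
returns false. -/
def FindsAbstractCounterexample (TI : IndexTheory LI) (TE : SMTTheory LE) (S : ArraySystem LI LE X)
    (φ : Formula LI LE X) (P : Set (Atom LI LE X ℕ)) : Prop :=
  (P = initPredicates S φ ∧ ¬ InitCheck TI TE S φ) ∨
  ∃ (k : ℕ) (F F' : Frames LI LE X) (M : Model TI TE) (σ : AbsValuation LI LE X M.I)
    (s : Valuation X M.I M.E) (ψ : AbsFormula LI LE X),
    Reaches TI TE S φ P k F ∧ IsBadModel φ P (F k) σ s ∧ IsDiagram P σ ψ ∧
    RecBlock TI TE S P F ψ k false F'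

end Algorithm

end UpdrIA

/-!
The argument follows an abstract counterexample from its initial end and shows that an inductive
invariant `χ ∈ 𝓛(P)` would hold at each of its states.

Validity of a universal formula is inherited by substructures. Concretely, let `(M, s)` and
`(N, t)` be combined models, and let `e` embed the index model of `M` into that of `N` so that every
`p ∈ P` has the same truth value at `ν` in `(M, s)` as at `e ∘ ν` in `(N, t)`. Then every `χ ∈ 𝓛(P)`
that holds in `(N, t)` holds in `(M, s)` (`holds_of_agreeAlong`). There are two sources of such maps:

* `EQ_P(s, t)` gives the identity;
* if `ψ` is the diagram of `(M, σ)` and is satisfied in `(N, σ')`, the satisfying assignment is an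
  embedding that preserves and reflects `X_P`, and `H_P` turns `X_P` into `P`
  (`exists_agreeAlong_of_isDiagram`).

Hence, if the pre-state of a model of `AbsRelInd(F, τ, ¬ψ, P)` satisfies `χ`, so does every state
whose diagram is `ψ` (`holds_of_absRelInd`). A call of `RecBlock` that returns false unwinds to a
chain of such models whose first pre-state lies in the frame `F₀`. That frame is `{ῑ}` throughout
every run, and all atoms of `ι` and `φ` are in `P`, so `χ` holds at the start of the chain. It
therefore holds at the last state, the one that violates `φ`, which contradicts `χ ⊨ φ`.
-/

namespace UpdrIA

open FirstOrder FirstOrder.Language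

/-! ### Quantifier prefixes and conjunctions -/

namespace Fml

variable {A M : Type u} (sat : (ℕ → M) → A → Prop)

/-- Validity under all assignments does not see a prefix of universal quantifiers. -/
lemma forall_realize_alls (l : List ℕ) (f : Fml A) :
    (∀ ν, (alls l f).Realize sat ν) ↔ ∀ ν, f.Realize sat ν := by
  induction l with
  | nil => rfl
  | cons i l ih =>
    rw [← ih]
    refine ⟨fun h ν => ?_, fun h ν m => h _⟩
    have h' := h ν (ν i)
    rwa [Function.update_eq_self] at h'

lemma exists_realize_of_exs {l : List ℕ} {f : Fml A} {ν : ℕ → M}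
    (h : (exs l f).Realize sat ν) : ∃ ν, f.Realize sat ν := by
  induction l generalizing ν with
  | nil => exact ⟨ν, h⟩
  | cons i l ih =>
    obtain ⟨m, hm⟩ := h
    exact ih hm

lemma realize_of_mem_conj {l : List (Fml A)} {ν : ℕ → M} (h : (conj l).Realize sat ν)
    {f : Fml A} (hf : f ∈ l) : f.Realize sat ν := by
  induction l with
  | nil => cases hf
  | cons g l ih =>
    rcases List.mem_cons.1 hf with rfl | hf
    · exact h.1
    · exact ih h.2 hf

end Fml

/-! ### Substitution and the abstraction of formulas -/

section Terms

variable {LI LE : FirstOrder.Language.{u, u}} {X : ArraySig.{u}} {V W : Type}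
  {I E : Type u} [LI.Structure I] [LE.Structure E] (s : Valuation X I E)

lemma IdxTerm.eval_ofTerm (ν : V → I) (t : LI.Term V) :
    (IdxTerm.ofTerm t : IdxTerm LI X V).eval s ν = t.realize ν := by
  induction t with
  | var v => rfl
  | func f ts ih =>
    simp only [IdxTerm.ofTerm, IdxTerm.eval, Term.realize, ih]

lemma IdxTerm.eval_subst (θ : V → IdxTerm LI X W) (ν : W → I) (t : IdxTerm LI X V) :
    (t.subst θ).eval s ν = t.eval s fun v => (θ v).eval s ν := by
  induction t with
  | var v => rfl
  | func f ts ih => simp only [IdxTerm.subst, IdxTerm.eval, ih]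
  | read x ts ih => simp only [IdxTerm.subst, IdxTerm.eval, ih]

lemma EltTerm.eval_subst (θ : V → IdxTerm LI X W) (ν : W → I) (t : EltTerm LI LE X V) :
    (t.subst θ).eval s ν = t.eval s fun v => (θ v).eval s ν := by
  induction t with
  | func f ts ih => simp only [EltTerm.subst, EltTerm.eval, ih]
  | read x ts => simp only [EltTerm.subst, EltTerm.eval, IdxTerm.eval_subst]

lemma Atom.realize_subst (θ : V → IdxTerm LI X W) (ν : W → I) (a : Atom LI LE X V) :
    (a.subst θ).Realize s ν ↔ a.Realize s fun v => (θ v).eval s ν := by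
  cases a <;> simp only [Atom.subst, Atom.Realize, IdxTerm.eval_subst, EltTerm.eval_subst]

variable {s}

lemma Formula.realize_bar {P : Set (Atom LI LE X ℕ)} {σ : AbsValuation LI LE X I}
    (hH : HoldsH P σ s) {f : Formula LI LE X} (hf : f.atoms ⊆ P) (ν : ℕ → I) :
    Fml.Realize (AbsAtom.Realize σ) f.bar ν ↔ Fml.Realize (Atom.Realize s) f ν := by
  unfold Formula.bar
  induction f generalizing ν with
  | fls => rfl
  | atom a => exact hH a (hf rfl) ν
  | neg f ih => exact not_congr (ih hf ν)
  | and f g ihf ihg =>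
    exact and_congr (ihf (Set.subset_union_left.trans hf) ν)
      (ihg (Set.subset_union_right.trans hf) ν)
  | or f g ihf ihg =>
    exact or_congr (ihf (Set.subset_union_left.trans hf) ν)
      (ihg (Set.subset_union_right.trans hf) ν)
  | all i f ih => exact forall_congr' fun m => ih hf _
  | ex i f ih => exact exists_congr fun m => ih hf _

lemma Formula.holds_bar {P : Set (Atom LI LE X ℕ)} {σ : AbsValuation LI LE X I}
    (hH : HoldsH P σ s) {f : Formula LI LE X} (hf : f.atoms ⊆ P) :
    AbsFormula.Holds f.bar σ ↔ f.Holds s :=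
  forall_congr' fun ν => f.realize_bar hH hf ν

end Terms

/-! ### Universal formulas and embeddings -/

section Embeddings

variable {LI LE : FirstOrder.Language.{u, u}} {X : ArraySig.{u}} {P : Set (Atom LI LE X ℕ)}
  {I E J D : Type u} [LI.Structure I] [LE.Structure E] [LI.Structure J] [LE.Structure D]

/-- The embedding `e` of index structures preserves and reflects the predicates in `P`, interpreted
by `s` in its domain and by `t` in its codomain. -/
def AgreeAlong (P : Set (Atom LI LE X ℕ)) (s : Valuation X I E) (t : Valuation X J D)
    (e : I ↪[LI] J) : Prop :=
  ∀ p ∈ P, ∀ ν : ℕ → I, p.Realize s ν ↔ p.Realize t (e ∘ ν)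

variable {s : Valuation X I E} {t : Valuation X J D} {e : I ↪[LI] J}

lemma AgreeAlong.realize_iff (h : AgreeAlong P s t e) {f : Formula LI LE X}
    (hf : Fml.IsBoolComb (indexAtoms LI LE X ∪ predicateInstances P) f) (ν : ℕ → I) :
    Fml.Realize (Atom.Realize s) f ν ↔ Fml.Realize (Atom.Realize t) f (e ∘ ν) := by
  induction hf with
  | fls => rfl
  | atom ha =>
    rcases ha with (⟨t₁, t₂, rfl⟩ | ⟨n, r, ts, rfl⟩) | ⟨p, hp, θ, rfl⟩
    · simp only [Fml.Realize, Atom.Realize, IdxTerm.eval_ofTerm, HomClass.realize_term,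
        e.injective.eq_iff]
    · simp only [Fml.Realize, Atom.Realize, IdxTerm.eval_ofTerm, HomClass.realize_term]
      exact (e.map_rel r _).symm
    · simp only [Fml.Realize, Atom.realize_subst, IdxTerm.eval_ofTerm, HomClass.realize_term]
      exact h p hp _
  | neg _ ih => exact not_congr ih
  | and _ _ ihf ihg => exact and_congr ihf ihg
  | or _ _ ihf ihg => exact or_congr ihf ihg

/-- Universal formulas over `Σ_I` and `P` are inherited by substructures. -/
lemma holds_of_agreeAlong (h : AgreeAlong P s t e) {χ : Formula LI LE X}
    (hχ : χ ∈ universalClass P) (ht : χ.Holds t) : χ.Holds s := by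
  obtain ⟨l, f, hf, -, rfl⟩ := hχ
  have ht' := (Fml.forall_realize_alls _ l f).1 ht
  exact (Fml.forall_realize_alls _ l f).2 fun ν => (h.realize_iff hf ν).2 (ht' _)

lemma holds_of_holdsEQ {s t : Valuation X I E} (h : HoldsEQ P s t) {χ : Formula LI LE X}
    (hχ : χ ∈ universalClass P) (hs : χ.Holds s) : χ.Holds t :=
  holds_of_agreeAlong (e := Embedding.refl LI I) (fun p hp ν => (h p hp ν).symm) hχ hs

/-- A structure that satisfies the diagram of a structure contains a copy of it. -/
lemma exists_agreeAlong_of_isDiagram {σ : AbsValuation LI LE X I} {σ' : AbsValuation LI LE X J}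
    (hs : HoldsH P σ s) (ht : HoldsH P σ' t) {ψ : AbsFormula LI LE X} (hψ : IsDiagram P σ ψ)
    {ν : ℕ → J} (hν : Fml.Realize (AbsAtom.Realize σ') ψ ν) :
    ∃ e : I ↪[LI] J, AgreeAlong P s t e := by
  obtain ⟨x, vs, ls, -, -, hls, rfl⟩ := hψ
  obtain ⟨μ, hμ⟩ := Fml.exists_realize_of_exs _ hν
  have lit {f} (hf : DiagramLiteral P σ x f) : Fml.Realize (AbsAtom.Realize σ') f μ :=
    Fml.realize_of_mem_conj _ hμ ((hls f).2 hf)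
  let e : I ↪[LI] J :=
    { toFun := fun m => μ (x m)
      inj' := fun m m' h => by
        by_contra hne
        exact lit (.ne m m' hne) h
      map_fun' := fun f ms => (lit (.func f ms)).symm
      map_rel' := fun r ms =>
        ⟨fun h => by_contra fun hn => lit (.relNeg r ms hn) h, fun h => lit (.relPos r ms h)⟩ }
  refine ⟨e, fun p hp ν => ?_⟩
  rw [← hs p hp ν, ← ht p hp (e ∘ ν)]
  exact ⟨fun h => lit (.predPos p hp _ h),
    fun h => by_contra fun hn => lit (.predNeg p hp _ hn) h⟩

end Embeddings

/-! ### Runs of the algorithm -/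

section Runs

variable {LI LE : FirstOrder.Language.{u, u}} {X : ArraySig.{u}} {TI : IndexTheory LI} {TE : SMTTheory LE}
  {S : ArraySystem LI LE X} {φ χ : Formula LI LE X} {P : Set (Atom LI LE X ℕ)}

lemma RecBlock.frame_zero {F F' : Frames LI LE X} {ψ : AbsFormula LI LE X} {N : ℕ} {b : Bool}
    (h : RecBlock TI TE S P F ψ N b F') : F' 0 = F 0 := by
  induction h with
  | zero => rfl
  | fail _ _ _ _ _ _ _ _ _ _ ih => exact ih
  | loop _ _ _ _ _ _ _ _ _ _ _ ih ih' => exact ih'.trans ih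
  | block => simp [Frames.add]

lemma propagate_zero (F : Frames LI LE X) (n : ℕ) : propagate TI TE S P F n 0 = F 0 := by
  induction n with
  | zero => rfl
  | succ n ih => simpa [propagate] using ih

lemma Reaches.initPredicates_subset_and_frame_zero {k : ℕ} {F : Frames LI LE X}
    (h : Reaches TI TE S φ P k F) : initPredicates S φ ⊆ P ∧ F 0 = {S.init.bar} := by
  induction h with
  | start => exact ⟨subset_rfl, by simp [initFrames]⟩
  | block _ _ _ _ _ _ hrec ih => exact ⟨ih.1, hrec.frame_zero.trans ih.2⟩
  | refine _ _ _ _ _ _ hrec _ _ ih =>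
    exact ⟨ih.1.trans Set.subset_union_left, hrec.frame_zero.trans ih.2⟩
  | extend _ _ hF' _ ih =>
    refine ⟨ih.1, ?_⟩
    rw [hF', propagate_zero, Function.update_of_ne (by omega), ih.2]

/-- If the pre-state of an abstract step into the diagram of `σ` satisfies an invariant in `𝓛(P)`,
so does every state whose abstraction is `σ`. -/
lemma holds_of_absRelInd (hχ : χ ∈ universalClass P) (hind : IsInductiveInvariantFor TI TE S φ χ)
    {F : Set (AbsFormula LI LE X)} {ψ : AbsFormula LI LE X} {M : Model TI TE}
    {σ₀ σ₁ : AbsValuation LI LE X M.I} {s s₁ s₁' s' : Valuation X M.I M.E}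
    (hsat : AbsRelInd S P F (.neg ψ) σ₀ s s₁ s₁' s' σ₁) (hs : χ.Holds s)
    {N : Model TI TE} {σ : AbsValuation LI LE X N.I} {t : Valuation X N.I N.E}
    (ht : HoldsH P σ t) (hψ : IsDiagram P σ ψ) : χ.Holds t := by
  have h₁ : χ.Holds s₁ := holds_of_holdsEQ hsat.eqPre hχ hs
  have h₁' : χ.Holds s₁' := hind.2.1 M s₁ s₁' h₁ hsat.step
  have hs' : χ.Holds s' := holds_of_holdsEQ hsat.eqPost hχ h₁'
  obtain ⟨ν, hν⟩ : ∃ ν, Fml.Realize (AbsAtom.Realize σ₁) ψ ν := by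
    by_contra hn
    exact hsat.post fun ν h => hn ⟨ν, h⟩
  obtain ⟨e, he⟩ := exists_agreeAlong_of_isDiagram ht hsat.absPost hψ hν
  exact holds_of_agreeAlong he hχ hs'

/-- An invariant in `𝓛(P)` holds in every state of the frame `F_N` on whose diagram `RecBlock`
fails at level `N`. The frame matters only for `N = 0`, where it forces the state to be initial. -/
lemma RecBlock.holds_of_false (hχ : χ ∈ universalClass P)
    (hind : IsInductiveInvariantFor TI TE S φ χ) (hP : S.init.atoms ⊆ P)
    {F F' : Frames LI LE X} {ψ : AbsFormula LI LE X} {N : ℕ}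
    (h : RecBlock TI TE S P F ψ N false F') (hF : F 0 = {S.init.bar})
    {M : Model TI TE} {σ : AbsValuation LI LE X M.I} {s : Valuation X M.I M.E}
    (hs : HoldsH P σ s) (hψ : IsDiagram P σ ψ) (hN : ∀ f ∈ F N, AbsFormula.Holds f σ) :
    χ.Holds s := by
  -- In the `loop` case the frames change before the last iteration, so that `hN` survives the
  -- induction only in the weakened form that concerns level `0`.
  replace hN : N = 0 → AbsFormula.Holds S.init.bar σ := by
    rintro rfl
    exact hN _ (hF ▸ rfl)
  generalize hb : false = b at h
  induction h generalizing M with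
  | zero F ψ => exact hind.1 M s ((Formula.holds_bar hs hP).1 (hN rfl))
  | fail M₀ σ₀ σ₁ s₀ s₁ s₁' s' hsat hdiag _ ih =>
    refine holds_of_absRelInd hχ hind hsat (ih hF hsat.absPre hdiag ?_ hb) hs hψ
    rintro rfl
    exact hsat.frame _ (hF ▸ rfl)
  | loop _ _ _ _ _ _ _ _ _ hrec _ _ ih =>
    exact ih (hrec.frame_zero.trans hF) hs hψ hN hb
  | block => cases hb

end Runs

end UpdrIA

theorem mainTheorem2 {LI LE : FirstOrder.Language.{u, u}}
    (TI : UpdrIA.IndexTheory LI) (TE : UpdrIA.SMTTheory LE) {X : UpdrIA.ArraySig.{u}}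
    (S : UpdrIA.ArraySystem LI LE X) (φ : UpdrIA.Formula LI LE X) (hφ : φ.IsClosed)
    (P : Set (UpdrIA.Atom LI LE X ℕ))
    (hcex : UpdrIA.FindsAbstractCounterexample TI TE S φ P) :
    ¬ ∃ χ ∈ UpdrIA.universalClass P, UpdrIA.IsInductiveInvariantFor TI TE S φ χ := by
  rintro ⟨χ, hχ, hind⟩
  rcases hcex with ⟨-, hinit⟩ | ⟨k, F, F', M, σ, s, ψ, hreach, hbad, hdiag, hrec⟩
  · refine hinit fun M σ s hι hH => ?_
    have hs : S.init.Holds s := (UpdrIA.Formula.holds_bar hH Set.subset_union_left).1 hι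
    exact (UpdrIA.Formula.holds_bar hH Set.subset_union_right).2
      (hind.2.2 M s (hind.1 M s hs))
  · obtain ⟨hP, hF⟩ := hreach.initPredicates_subset_and_frame_zero
    have hs : χ.Holds s := hrec.holds_of_false hχ hind (Set.subset_union_left.trans hP) hF
      hbad.absRel hdiag hbad.frame
    exact hbad.bad ((UpdrIA.Formula.holds_bar hbad.absRel (Set.subset_union_right.trans hP)).2
      (hind.2.2 M s hs))
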